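/- Let $(X^{2n},\omega=d\lambda)$ be an exact symplectic manifold with corners (for example a Liouville sector). An \emph{exact Lagrangian} in $X$ is the image of a smooth proper embedding $i\colon M^n\to X$ of an $n$-manifold without boundary, with image in the interior of $X$, such that $i^*\omega=0$ and $i^*\lambda$ is an exact one-form. An \emph{exact Lagrangian isotopy} is a smooth family $(i_t\colon M\to X)_{t\in[0,1]}$ of such embeddings for which the map $[0,1]\times M\to X$, $(t,m)\mapsto i_t(m)$, is proper; it joins $i_0(M)$ to $i_1(M)$. A (two-component) \emph{Lagrangian link} is a disjoint union of two exact Lagrangians, and an \emph{isotopy of links} is a pair of exact Lagrangian isotopies of the components whose images are disjoint at every time $t\in[0,1]$. Let $T^*D^1=[-1,1]\times\mathbb R$ with coordinates $(q,p)$ and one-form $p\,dq$, let $T^*_0D^1=\{q=0\}$, and equip $X\times T^*D^1$ with the one-form $\lambda+p\,dq$ and its exterior derivative. Let $L\sqcup K$ and $L'\sqcup K'$ be Lagrangian links in $X$ that are component-wise isotopic: there are an exact Lagrangian isotopy $(i_t)$ in $X$ from $L$ to $L'$ and an exact Lagrangian isotopy $(j_t)$ in $X$ from $K$ to $K'$ (which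 may intersect each other). Then the stabilized links $$(L\times T^*_0D^1)\sqcup(K\times T^*_0D^1)\quad\text{and}\quad(L'\times T^*_0D^1)\sqcup(K'\times T^*_0D^1)$$ are isotopic as Lagrangian links in $X\times T^*D^1$. Moreover, the link isotopy $(I_t,J_t)$ can be chosen so that strong exactness is preserved: for every $t\in[0,1]$ and every one-form $\mu$ on $X$, if $i_t^*\mu=0$ then $I_t^*(\mu+p\,dq)=0$, and if $j_t^*\mu=0$ then $J_t^*(\mu+p\,dq)=0$. -/

import Mathlib

open Set
open scoped Manifold ContDiff

noncomputable section

section Forms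

variable {E : Type*} [NormedAddCommGroup E] [NormedSpace ℝ E]
  {H : Type*} [TopologicalSpace H] (I : ModelWithCorners ℝ E H)
  (X : Type*) [TopologicalSpace X] [ChartedSpace H X]

/-- A (not necessarily smooth) differential one-form on the manifold with corners `X`. -/
abbrev OneForm : Type _ := ∀ x : X, TangentSpace I x →L[ℝ] ℝ

variable {X}

/-- Smoothness of a one-form, as a section of the cotangent bundle. -/
def OneForm.IsSmooth [IsManifold I ∞ X] (θ : OneForm I X) : Prop :=
  ContMDiff I (I.prod 𝓘(ℝ, E →L[ℝ] ℝ)) ∞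
    (fun x : X => Bundle.TotalSpace.mk' (E →L[ℝ] ℝ)
      (E := fun x : X => TangentSpace I x →L[ℝ] Bundle.Trivial X ℝ x) x (θ x))

/-- The expression of the one-form `θ` in the preferred chart at `x`, i.e. its pullback to the
model vector space under the inverse of that chart. -/
def OneForm.inChart (θ : OneForm I X) (x : X) (y : E) : E →L[ℝ] ℝ :=
  (θ ((extChartAt I x).symm y)).comp
    (mfderivWithin 𝓘(ℝ, E) I (extChartAt I x).symm (range I) y)

/-- The exterior derivative `dθ` at `x`, evaluated on two tangent vectors: in the preferred chart
at `x` (whose differential at `x` is the identification of the tangent space at `x` with `E`),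
`dθ (u, v) = D_u θ (v) - D_v θ (u)`. -/
def OneForm.d (θ : OneForm I X) (x : X) (u v : TangentSpace I x) : ℝ :=
  (fderivWithin ℝ (θ.inChart I x) (range I) (extChartAt I x x) : E →L[ℝ] E →L[ℝ] ℝ) u v -
    (fderivWithin ℝ (θ.inChart I x) (range I) (extChartAt I x x) : E →L[ℝ] E →L[ℝ] ℝ) v u

/-- `(X, dθ)` is an exact symplectic manifold with corners: the one-form `θ` is smooth and
the two-form `dθ` is nondegenerate at every point. -/
structure IsExactSymplectic [IsManifold I ∞ X] (θ : OneForm I X) : Prop where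
  smooth : θ.IsSmooth I
  nondegenerate : ∀ (x : X) (u : TangentSpace I x), (∀ v, θ.d I x u v = 0) → u = 0

end Forms

section Lagrangians

variable {E : Type*} [NormedAddCommGroup E] [NormedSpace ℝ E]
  {H : Type*} [TopologicalSpace H] (I : ModelWithCorners ℝ E H)
  {X : Type*} [TopologicalSpace X] [ChartedSpace H X]
  {F : Type*} [NormedAddCommGroup F] [NormedSpace ℝ F]
  {G : Type*} [TopologicalSpace G] (J : ModelWithCorners ℝ F G)
  {M : Type*} [TopologicalSpace M] [ChartedSpace G M]
  {N : Type*} [TopologicalSpace N] [ChartedSpace G N]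

/-- The pullback `f^* θ`, at the point `m`. -/
def OneForm.pullback (θ : OneForm I X) (f : M → X) : OneForm J M :=
  fun m => (θ (f m)).comp (mfderiv J I f m)

/-- `f : M → X` is a proper embedding into the interior of `X` whose image is an
exact Lagrangian submanifold of `(X, dθ)`. -/
structure IsExactLagrangianEmbedding (θ : OneForm I X) (f : M → X) : Prop where
  smooth : ContMDiff J I ∞ f
  injective : Function.Injective f
  injective_mfderiv : ∀ m, Function.Injective (mfderiv J I f m)
  proper : IsProperMap f
  interior : ∀ m, f m ∈ I.interior X
  half_dim : 2 * Module.finrank ℝ F = Module.finrank ℝ E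
  isotropic : ∀ (m : M) (u v : TangentSpace J m),
    θ.d I (f m) (mfderiv J I f m u) (mfderiv J I f m v) = 0
  exact : ∃ g : M → ℝ, ContMDiff J 𝓘(ℝ, ℝ) ∞ g ∧
    ∀ (m : M) (u : TangentSpace J m), θ.pullback I J f m u = mfderiv J 𝓘(ℝ, ℝ) g m u

/-- `φ t`, for `t ∈ [0, 1]`, is an isotopy of properly embedded exact Lagrangians: it is smooth
in both variables, it is proper as a family, and every stage is a proper exact Lagrangian
embedding. Values at times outside `[0, 1]` are irrelevant. -/
structure IsExactLagrangianIsotopy (θ : OneForm I X) (φ : ℝ → M → X) : Prop where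
  smooth : ContMDiffOn (𝓘(ℝ, ℝ).prod J) I ∞ (fun p : ℝ × M => φ p.1 p.2)
    (Icc (0 : ℝ) 1 ×ˢ univ)
  proper : IsProperMap (fun p : Icc (0 : ℝ) 1 × M => φ p.1 p.2)
  embedding : ∀ t ∈ Icc (0 : ℝ) 1, IsExactLagrangianEmbedding I J θ (φ t)

/-- An isotopy of two-component Lagrangian links: the two components move by exact Lagrangian
isotopies and stay disjoint from each other at all times. -/
structure IsExactLagrangianLinkIsotopy (θ : OneForm I X) (φ : ℝ → M → X) (ψ : ℝ → N → X) :
    Prop where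
  first : IsExactLagrangianIsotopy I J θ φ
  second : IsExactLagrangianIsotopy I J θ ψ
  disjoint : ∀ t ∈ Icc (0 : ℝ) 1, Disjoint (range (φ t)) (range (ψ t))

end Lagrangians

section Stabilization

instance fact_neg_one_lt_one : Fact ((-1 : ℝ) < 1) := ⟨by norm_num⟩

/-- The cotangent bundle `T^*D^1` of `D^1 = [-1, 1]`, with coordinates `(q, p)`. -/
abbrev CotangentDisk : Type := Icc (-1 : ℝ) 1 × ℝ

/-- The model with corners of `T^*D^1`. -/
abbrev cotangentDiskModel :
    ModelWithCorners ℝ (EuclideanSpace ℝ (Fin 1) × ℝ) (ModelProd (EuclideanHalfSpace 1) ℝ) :=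
  (𝓡∂ 1).prod 𝓘(ℝ, ℝ)

/-- The one-form `dq` on `T^*D^1`. -/
def baseDifferential : OneForm cotangentDiskModel CotangentDisk :=
  fun z => mfderiv cotangentDiskModel 𝓘(ℝ, ℝ) (fun w : CotangentDisk => (w.1 : ℝ)) z

/-- The canonical one-form `p dq` on `T^*D^1`. -/
def canonicalForm : OneForm cotangentDiskModel CotangentDisk :=
  fun z => z.2 • baseDifferential z

/-- The cotangent fiber `T^*_0 D^1`. -/
def zeroFiber : Set CotangentDisk := {z | (z.1 : ℝ) = 0}

variable {E : Type*} [NormedAddCommGroup E] [NormedSpace ℝ E]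
  {H : Type*} [TopologicalSpace H] (I : ModelWithCorners ℝ E H)
  {X : Type*} [TopologicalSpace X] [ChartedSpace H X]

/-- The product one-form `θ + p dq` on the stabilization `X × T^*D^1`. -/
def OneForm.stabilize (θ : OneForm I X) :
    OneForm (I.prod cotangentDiskModel) (X × CotangentDisk) :=
  fun z =>
    (θ z.1).comp (mfderiv (I.prod cotangentDiskModel) I Prod.fst z) +
      (canonicalForm z.2).comp
        (mfderiv (I.prod cotangentDiskModel) cotangentDiskModel Prod.snd z)

end Stabilization

end

/-!
A product of exact Lagrangians is an exact Lagrangian for the sum of the one-forms, and the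
cotangent fibers `T^*_q D^1` with `|q| < 1` are exact Lagrangians along which `p dq` vanishes.
Move the first component of the stabilized link by the given isotopy times the fiber over
`q = t (1 - t)`, and the second one by the given isotopy times the fiber over `q = 0`. For
`0 < t < 1` the two fibers are distinct, so the components are disjoint however the given isotopies
intersect, while at `t = 0` and `t = 1` both fibers are `T^*_0 D^1` and the original links are
disjoint.
-/

open Topology

section ProperMaps

variable {T A B Y Z : Type*} [TopologicalSpace T] [TopologicalSpace A] [TopologicalSpace B]
  [TopologicalSpace Y] [TopologicalSpace Z]

theorem isClosedEmbedding_prod_diag [T2Space T] :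
    IsClosedEmbedding fun p : T × A × B => ((p.1, p.2.1), (p.1, p.2.2)) where
  toIsEmbedding := .of_leftInverse (f := fun w : (T × A) × T × B => (w.1.1, w.1.2, w.2.2))
    (fun _ => rfl) (by fun_prop) (by fun_prop)
  isClosed_range := by
    have range_eq : range (fun p : T × A × B => ((p.1, p.2.1), (p.1, p.2.2))) =
        {w | w.1.1 = w.2.1} := by
      ext ⟨⟨t, a⟩, s, b⟩
      simp [eq_comm]
    rw [range_eq]
    exact isClosed_eq (by fun_prop) (by fun_prop)

theorem isProperMap_prodMap_family [T2Space T] {f : T → A → Y} {g : T → B → Z}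
    (hf : IsProperMap fun p : T × A => f p.1 p.2) (hg : IsProperMap fun p : T × B => g p.1 p.2) :
    IsProperMap fun p : T × A × B => Prod.map (f p.1) (g p.1) p.2 :=
  (hf.prodMap hg).comp isClosedEmbedding_prod_diag.isProperMap

end ProperMaps

section Coprod

open ContinuousLinearMap

variable {𝕜 V W E F G : Type*} [NontriviallyNormedField 𝕜]
  [NormedAddCommGroup V] [NormedSpace 𝕜 V] [NormedAddCommGroup W] [NormedSpace 𝕜 W]
  [NormedAddCommGroup E] [NormedSpace 𝕜 E] [NormedAddCommGroup F] [NormedSpace 𝕜 F]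
  [NormedAddCommGroup G] [NormedSpace 𝕜 G]

theorem hasFDerivWithinAt_coprod {A : V → E →L[𝕜] G} {A' : V →L[𝕜] E →L[𝕜] G}
    {B : W → F →L[𝕜] G} {B' : W →L[𝕜] F →L[𝕜] G} {s : Set V} {t : Set W} {z : V × W}
    (hA : HasFDerivWithinAt A A' s z.1) (hB : HasFDerivWithinAt B B' t z.2) :
    HasFDerivWithinAt (fun y => (A y.1).coprod (B y.2))
      ((coprodEquivL (S := 𝕜)).toContinuousLinearMap ∘L A'.prodMap B') (s ×ˢ t) z := by
  let C := (coprodEquivL (E := E) (F := F) (G := G) (𝕜 := 𝕜) 𝕜).toContinuousLinearMap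
  have prodMap_deriv : HasFDerivWithinAt (Prod.map A B) (A'.prodMap B') (s ×ˢ t) z :=
    .prodMap _ (hA.mono (fst_image_prod_subset _ _)) (hB.mono (snd_image_prod_subset _ _))
  exact C.hasFDerivAt.comp_hasFDerivWithinAt z prodMap_deriv

end Coprod

section OneForms

variable {E : Type*} [NormedAddCommGroup E] [NormedSpace ℝ E]
  {H : Type*} [TopologicalSpace H] {I : ModelWithCorners ℝ E H}
  {X : Type*} [TopologicalSpace X] [ChartedSpace H X]

namespace OneForm

theorem inChart_eventuallyEq_inCoordinates [IsManifold I 1 X] (α : OneForm I X) (x : X) :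
    α.inChart I x =ᶠ[𝓝[range I] extChartAt I x x] fun y =>
      ContinuousLinearMap.inCoordinates E (TangentSpace I) ℝ (Bundle.Trivial X ℝ) x
        ((extChartAt I x).symm y) x ((extChartAt I x).symm y) (α ((extChartAt I x).symm y)) := by
  filter_upwards [extChartAt_target_mem_nhdsWithin (I := I) x] with y hy
  have mem_source : (extChartAt I x).symm y ∈ (chartAt H x).source := by
    simpa using (extChartAt I x).map_target hy
  have trivial_eq_id : (trivializationAt ℝ (Bundle.Trivial X ℝ) x).continuousLinearMapAt ℝ
      ((extChartAt I x).symm y) = ContinuousLinearMap.id ℝ ℝ :=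
    Bundle.Trivial.continuousLinearMapAt_trivialization ℝ X ℝ _
  ext v
  simp only [OneForm.inChart, ContinuousLinearMap.inCoordinates,
    TangentBundle.symmL_trivializationAt mem_source]
  rw [(extChartAt I x).right_inv hy]
  exact (DFunLike.congr_fun trivial_eq_id _).symm

theorem isSmooth_iff_contDiffWithinAt_inChart [IsManifold I ∞ X] {α : OneForm I X} :
    α.IsSmooth I ↔
      ∀ x, ContDiffWithinAt ℝ ∞ (α.inChart I x) (range I) (extChartAt I x x) := by
  have : IsManifold I 1 X := .of_le (n := ∞) (by simp)
  refine forall_congr' fun x => ?_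
  refine (contMDiffAt_hom_bundle _).trans ((and_iff_right contMDiffAt_id).trans ?_)
  rw [contMDiffAt_iff_source, contMDiffWithinAt_iff_contDiffWithinAt]
  exact ((α.inChart_eventuallyEq_inCoordinates x).congr_contDiffWithinAt_of_mem
    (extChartAt_target_subset_range x (mem_extChartAt_target x))).symm

theorem IsSmooth.differentiableWithinAt_inChart [IsManifold I ∞ X] {α : OneForm I X}
    (hα : α.IsSmooth I) (x : X) :
    DifferentiableWithinAt ℝ (α.inChart I x) (range I) (extChartAt I x x) :=
  (isSmooth_iff_contDiffWithinAt_inChart.1 hα x).differentiableWithinAt (by simp)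

theorem IsSmooth.smul [IsManifold I ∞ X] {α : OneForm I X} (hα : α.IsSmooth I) {g : X → ℝ}
    (hg : ContMDiff I 𝓘(ℝ, ℝ) ∞ g) : OneForm.IsSmooth I (g • α) :=
  isSmooth_iff_contDiffWithinAt_inChart.2 fun x =>
    (contMDiffAt_iff.1 (hg x)).2.smul (isSmooth_iff_contDiffWithinAt_inChart.1 hα x)

variable (I) in
/-- The differential `dg` of a function `g`, as a one-form. -/
noncomputable def differential (g : X → ℝ) : OneForm I X :=
  fun x => mfderiv I 𝓘(ℝ, ℝ) g x

theorem inChart_differential [IsManifold I 1 X] {g : X → ℝ} (hg : MDifferentiable I 𝓘(ℝ, ℝ) g)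
    (x : X) {y : E} (hy : y ∈ (extChartAt I x).target) :
    (differential I g).inChart I x y =
      fderivWithin ℝ (g ∘ (extChartAt I x).symm) (range I) y := by
  have unique : UniqueMDiffWithinAt 𝓘(ℝ, E) (range I) y :=
    I.uniqueDiffOn.uniqueMDiffOn y (extChartAt_target_subset_range x hy)
  rw [← mfderivWithin_eq_fderivWithin]
  exact (mfderiv_comp_mfderivWithin y (hg _) (mdifferentiableWithinAt_extChartAt_symm hy)
    unique).symm

theorem isSmooth_differential [IsManifold I ∞ X] {g : X → ℝ} (hg : ContMDiff I 𝓘(ℝ, ℝ) ∞ g) :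
    (differential I g).IsSmooth I := by
  have : IsManifold I 1 X := .of_le (n := ∞) (by simp)
  refine isSmooth_iff_contDiffWithinAt_inChart.2 fun x => ?_
  have mem_range : extChartAt I x x ∈ range I :=
    extChartAt_target_subset_range x (mem_extChartAt_target x)
  refine ((contMDiffAt_iff.1 (hg x)).2.fderivWithin_right I.uniqueDiffOn (by simp)
    mem_range).congr_of_eventuallyEq_of_mem ?_ mem_range
  filter_upwards [extChartAt_target_mem_nhdsWithin (I := I) x] with y hy using
    inChart_differential (hg.mdifferentiable (by simp)) x hy

theorem d_smul_smul (α : OneForm I X) (x : X) (w : TangentSpace I x) (a b : ℝ) :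
    α.d I x (a • w) (b • w) = 0 := by
  have alternating (D : E →L[ℝ] E →L[ℝ] ℝ) (w : E) :
      D (a • w) (b • w) - D (b • w) (a • w) = 0 := by
    simp only [map_smul, smul_apply, smul_eq_mul]
    ring
  exact alternating _ w

variable {F : Type*} [NormedAddCommGroup F] [NormedSpace ℝ F]
  {G : Type*} [TopologicalSpace G] {J : ModelWithCorners ℝ F G}
  {M : Type*} [TopologicalSpace M] [ChartedSpace G M]

theorem pullback_smul (g : X → ℝ) (α : OneForm I X) (f : M → X) :
    OneForm.pullback I J (g • α) f = (g ∘ f) • α.pullback I J f :=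
  rfl

theorem pullback_differential {g : X → ℝ} (hg : MDifferentiable I 𝓘(ℝ, ℝ) g) {f : M → X}
    (hf : MDifferentiable J I f) :
    (differential I g).pullback I J f = differential J (g ∘ f) :=
  funext fun m => (mfderiv_comp m (hg _) (hf m)).symm

theorem differential_const (a : ℝ) : differential I (fun _ : X => a) = 0 :=
  funext fun _ => mfderiv_const

section Prod

variable {E₂ : Type*} [NormedAddCommGroup E₂] [NormedSpace ℝ E₂]
  {H₂ : Type*} [TopologicalSpace H₂] {I₂ : ModelWithCorners ℝ E₂ H₂}
  {Y : Type*} [TopologicalSpace Y] [ChartedSpace H₂ Y]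

/-- The sum `α + β` of a one-form on `X` and a one-form on `Y`, as a one-form on `X × Y`. It is
written as a coproduct because a tangent space of `X × Y` is by definition a product. -/
noncomputable def prod (α : OneForm I X) (β : OneForm I₂ Y) : OneForm (I.prod I₂) (X × Y) :=
  fun z => ContinuousLinearMap.coprod (M₁ := E) (M₂ := E₂) (α z.1) (β z.2)

theorem stabilize_eq_prod (α : OneForm I X) : α.stabilize I = α.prod canonicalForm := by
  ext z v
  simp only [stabilize, mfderiv_fst, mfderiv_snd]
  rfl

theorem prod_zero_zero : (0 : OneForm I X).prod (0 : OneForm I₂ Y) = 0 :=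
  funext fun _ => ContinuousLinearMap.ext fun _ => add_zero 0

theorem differential_prod_differential {g : X → ℝ} (hg : MDifferentiable I 𝓘(ℝ, ℝ) g)
    {h : Y → ℝ} (hh : MDifferentiable I₂ 𝓘(ℝ, ℝ) h) :
    (differential I g).prod (differential I₂ h) =
      differential (I.prod I₂) fun z : X × Y => g z.1 + h z.2 := by
  ext z v
  have deriv_fst := (hg z.1).hasMFDerivAt.comp z (hasMFDerivAt_fst z (I := I) (I' := I₂))
  have deriv_snd := (hh z.2).hasMFDerivAt.comp z (hasMFDerivAt_snd z (I := I) (I' := I₂))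
  exact DFunLike.congr_fun (deriv_fst.add deriv_snd).mfderiv.symm v

variable {F₂ : Type*} [NormedAddCommGroup F₂] [NormedSpace ℝ F₂]
  {G₂ : Type*} [TopologicalSpace G₂] {J₂ : ModelWithCorners ℝ F₂ G₂}
  {P : Type*} [TopologicalSpace P] [ChartedSpace G₂ P]

theorem pullback_prod_prodMap (α : OneForm I X) (β : OneForm I₂ Y) {f : M → X}
    (hf : MDifferentiable J I f) {g : P → Y} (hg : MDifferentiable J₂ I₂ g) :
    (α.prod β).pullback (I.prod I₂) (J.prod J₂) (Prod.map f g) =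
      (α.pullback I J f).prod (β.pullback I₂ J₂ g) := by
  ext z : 1
  simp only [pullback, mfderiv_prodMap (hf z.1) (hg z.2)]
  rfl

theorem inChart_prod [IsManifold I 1 X] [IsManifold I₂ 1 Y] (α : OneForm I X) (β : OneForm I₂ Y)
    (z : X × Y) {y : E × E₂} (hy : y ∈ (extChartAt (I.prod I₂) z).target) :
    (α.prod β).inChart (I.prod I₂) z y =
      (α.inChart I z.1 y.1).coprod (β.inChart I₂ z.2 y.2) := by
  rw [extChartAt_prod] at hy
  have deriv_symm : mfderivWithin 𝓘(ℝ, E × E₂) (I.prod I₂) (extChartAt (I.prod I₂) z).symm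
      (range (I.prod I₂)) y =
      (mfderivWithin 𝓘(ℝ, E) I (extChartAt I z.1).symm (range I) y.1).prodMap
        (mfderivWithin 𝓘(ℝ, E₂) I₂ (extChartAt I₂ z.2).symm (range I₂) y.2) := by
    rw [extChartAt_prod, PartialEquiv.prod_symm, PartialEquiv.prod_coe,
      ModelWithCorners.range_prod, modelWithCornersSelf_prod, ← chartedSpaceSelf_prod]
    exact mfderivWithin_prodMap (mdifferentiableWithinAt_extChartAt_symm hy.1)
      (mdifferentiableWithinAt_extChartAt_symm hy.2)
      (I.uniqueDiffOn.uniqueMDiffOn _ (extChartAt_target_subset_range z.1 hy.1))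
      (I₂.uniqueDiffOn.uniqueMDiffOn _ (extChartAt_target_subset_range z.2 hy.2))
  unfold inChart
  rw [deriv_symm, extChartAt_prod]
  rfl

theorem d_prod [IsManifold I 1 X] [IsManifold I₂ 1 Y] {α : OneForm I X} {β : OneForm I₂ Y}
    {z : X × Y}
    (hα : DifferentiableWithinAt ℝ (α.inChart I z.1) (range I) (extChartAt I z.1 z.1))
    (hβ : DifferentiableWithinAt ℝ (β.inChart I₂ z.2) (range I₂) (extChartAt I₂ z.2 z.2))
    (u v : TangentSpace (I.prod I₂) z) :
    (α.prod β).d (I.prod I₂) z u v = α.d I z.1 u.1 v.1 + β.d I₂ z.2 u.2 v.2 := by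
  have mem_range : extChartAt (I.prod I₂) z z ∈ range (I.prod I₂) :=
    extChartAt_target_subset_range z (mem_extChartAt_target z)
  have chart_eq : (α.prod β).inChart (I.prod I₂) z =ᶠ[𝓝[range (I.prod I₂)]
      extChartAt (I.prod I₂) z z] fun y => (α.inChart I z.1 y.1).coprod (β.inChart I₂ z.2 y.2) := by
    filter_upwards [extChartAt_target_mem_nhdsWithin (I := I.prod I₂) z] with y hy using
      inChart_prod α β z hy
  have hasFDeriv := hasFDerivWithinAt_coprod (z := extChartAt (I.prod I₂) z z)
    hα.hasFDerivWithinAt hβ.hasFDerivWithinAt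
  rw [← ModelWithCorners.range_prod] at hasFDeriv
  unfold OneForm.d
  rw [(hasFDeriv.congr_of_eventuallyEq chart_eq
    (chart_eq.self_of_nhdsWithin mem_range)).fderivWithin ((I.prod I₂).uniqueDiffOn _ mem_range)]
  exact add_sub_add_comm _ _ _ _

end Prod

end OneForm

end OneForms

section LagrangianProducts

variable {E : Type*} [NormedAddCommGroup E] [NormedSpace ℝ E] [FiniteDimensional ℝ E]
  {H : Type*} [TopologicalSpace H] {I : ModelWithCorners ℝ E H}
  {X : Type*} [TopologicalSpace X] [ChartedSpace H X] [IsManifold I ∞ X]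
  {E₂ : Type*} [NormedAddCommGroup E₂] [NormedSpace ℝ E₂] [FiniteDimensional ℝ E₂]
  {H₂ : Type*} [TopologicalSpace H₂] {I₂ : ModelWithCorners ℝ E₂ H₂}
  {Y : Type*} [TopologicalSpace Y] [ChartedSpace H₂ Y] [IsManifold I₂ ∞ Y]
  {F : Type*} [NormedAddCommGroup F] [NormedSpace ℝ F] [FiniteDimensional ℝ F]
  {G : Type*} [TopologicalSpace G] {J : ModelWithCorners ℝ F G}
  {M : Type*} [TopologicalSpace M] [ChartedSpace G M]
  {F₂ : Type*} [NormedAddCommGroup F₂] [NormedSpace ℝ F₂] [FiniteDimensional ℝ F₂]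
  {G₂ : Type*} [TopologicalSpace G₂] {J₂ : ModelWithCorners ℝ F₂ G₂}
  {P : Type*} [TopologicalSpace P] [ChartedSpace G₂ P]
  {α : OneForm I X} {β : OneForm I₂ Y}

theorem IsExactLagrangianEmbedding.prodMap (hα : α.IsSmooth I) (hβ : β.IsSmooth I₂)
    {f : M → X} (hf : IsExactLagrangianEmbedding I J α f)
    {g : P → Y} (hg : IsExactLagrangianEmbedding I₂ J₂ β g) :
    IsExactLagrangianEmbedding (I.prod I₂) (J.prod J₂) (α.prod β) (Prod.map f g) := by
  have f_mdiff : MDifferentiable J I f := hf.smooth.mdifferentiable (by simp)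
  have g_mdiff : MDifferentiable J₂ I₂ g := hg.smooth.mdifferentiable (by simp)
  have deriv_prodMap (z : M × P) : mfderiv (J.prod J₂) (I.prod I₂) (Prod.map f g) z =
      (mfderiv J I f z.1).prodMap (mfderiv J₂ I₂ g z.2) :=
    mfderiv_prodMap (f_mdiff z.1) (g_mdiff z.2)
  refine ⟨hf.smooth.prodMap hg.smooth, hf.injective.prodMap hg.injective, fun z => ?_,
    hf.proper.prodMap hg.proper, fun z => ?_, ?_, fun z u v => ?_, ?_⟩
  · rw [deriv_prodMap]
    exact (hf.injective_mfderiv z.1).prodMap (hg.injective_mfderiv z.2)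
  · rw [ModelWithCorners.interior_prod]
    exact ⟨hf.interior z.1, hg.interior z.2⟩
  · rw [Module.finrank_prod, Module.finrank_prod, mul_add, hf.half_dim, hg.half_dim]
  · have : IsManifold I 1 X := .of_le (n := ∞) (by simp)
    have : IsManifold I₂ 1 Y := .of_le (n := ∞) (by simp)
    rw [deriv_prodMap, OneForm.d_prod (hα.differentiableWithinAt_inChart _)
      (hβ.differentiableWithinAt_inChart _)]
    exact (congrArg₂ (· + ·) (hf.isotropic z.1 u.1 v.1) (hg.isotropic z.2 u.2 v.2)).trans
      (add_zero 0)
  · obtain ⟨a, a_smooth, pullback_f⟩ := hf.exact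
    obtain ⟨b, b_smooth, pullback_g⟩ := hg.exact
    have pullback_f : α.pullback I J f = .differential J a :=
      funext fun m => ContinuousLinearMap.ext (pullback_f m)
    have pullback_g : β.pullback I₂ J₂ g = .differential J₂ b :=
      funext fun m => ContinuousLinearMap.ext (pullback_g m)
    refine ⟨fun z => a z.1 + b z.2, (a_smooth.comp contMDiff_fst).add
      (b_smooth.comp contMDiff_snd), fun z u => ?_⟩
    rw [OneForm.pullback_prod_prodMap α β f_mdiff g_mdiff, pullback_f, pullback_g,
      OneForm.differential_prod_differential (a_smooth.mdifferentiable (by simp))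
        (b_smooth.mdifferentiable (by simp))]
    rfl

theorem IsExactLagrangianIsotopy.prodMap (hα : α.IsSmooth I) (hβ : β.IsSmooth I₂)
    {φ : ℝ → M → X} (hφ : IsExactLagrangianIsotopy I J α φ)
    {χ : ℝ → P → Y} (hχ : IsExactLagrangianIsotopy I₂ J₂ β χ) :
    IsExactLagrangianIsotopy (I.prod I₂) (J.prod J₂) (α.prod β)
      fun t => Prod.map (φ t) (χ t) where
  smooth := by
    have φ_smooth : ContMDiffOn (𝓘(ℝ, ℝ).prod (J.prod J₂)) I ∞
        (fun p : ℝ × M × P => φ p.1 p.2.1) (Icc 0 1 ×ˢ univ) :=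
      hφ.smooth.comp (contMDiff_fst.prodMk (contMDiff_fst.comp contMDiff_snd)).contMDiffOn
        fun _ hp => ⟨hp.1, trivial⟩
    have χ_smooth : ContMDiffOn (𝓘(ℝ, ℝ).prod (J.prod J₂)) I₂ ∞
        (fun p : ℝ × M × P => χ p.1 p.2.2) (Icc 0 1 ×ˢ univ) :=
      hχ.smooth.comp (contMDiff_fst.prodMk (contMDiff_snd.comp contMDiff_snd)).contMDiffOn
        fun _ hp => ⟨hp.1, trivial⟩
    exact φ_smooth.prodMk χ_smooth
  proper := isProperMap_prodMap_family (f := fun t : Icc (0 : ℝ) 1 => φ t)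
    (g := fun t : Icc (0 : ℝ) 1 => χ t) hφ.proper hχ.proper
  embedding t ht := (hφ.embedding t ht).prodMap hα hβ (hχ.embedding t ht)

end LagrangianProducts

section CotangentFibers

theorem contMDiff_baseCoordinate :
    ContMDiff cotangentDiskModel 𝓘(ℝ, ℝ) ∞ fun z : CotangentDisk => (z.1 : ℝ) :=
  contMDiff_subtypeVal_Icc.comp contMDiff_fst

theorem canonicalForm_eq_smul_differential :
    canonicalForm = (Prod.snd : CotangentDisk → ℝ) •
      OneForm.differential cotangentDiskModel fun z : CotangentDisk => (z.1 : ℝ) :=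
  rfl

theorem isSmooth_canonicalForm : canonicalForm.IsSmooth cotangentDiskModel :=
  (OneForm.isSmooth_differential contMDiff_baseCoordinate).smul contMDiff_snd

/-- The parametrization of the cotangent fiber `T^*_q D^1` by `p`. Moving `q` gives the extra
room in which the components of a stabilized link pass each other. -/
def cotangentFiber (q : Icc (-1 : ℝ) 1) (p : ℝ) : CotangentDisk :=
  (q, p)

theorem range_cotangentFiber (q : Icc (-1 : ℝ) 1) :
    range (cotangentFiber q) = {z | z.1 = q} := by
  ext ⟨q', p⟩
  simp [cotangentFiber, eq_comm]

theorem range_cotangentFiber_eq_zeroFiber {q : Icc (-1 : ℝ) 1} (hq : (q : ℝ) = 0) :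
    range (cotangentFiber q) = zeroFiber := by
  simp only [range_cotangentFiber, zeroFiber, Subtype.ext_iff, hq]

theorem range_prodMap_cotangentFiber {X M : Type*} (f : M → X) {q : Icc (-1 : ℝ) 1}
    (hq : (q : ℝ) = 0) : range (Prod.map f (cotangentFiber q)) = range f ×ˢ zeroFiber := by
  rw [range_prodMap, range_cotangentFiber_eq_zeroFiber hq]

theorem disjoint_range_cotangentFiber {q q' : Icc (-1 : ℝ) 1} (hq : q ≠ q') :
    Disjoint (range (cotangentFiber q)) (range (cotangentFiber q')) := by
  rw [range_cotangentFiber, range_cotangentFiber]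
  exact disjoint_left.2 fun _ hz hz' => hq (hz.symm.trans hz')

theorem contMDiff_cotangentFiber (q : Icc (-1 : ℝ) 1) :
    ContMDiff 𝓘(ℝ, ℝ) cotangentDiskModel ∞ (cotangentFiber q) :=
  contMDiff_const.prodMk contMDiff_id

theorem pullback_canonicalForm_cotangentFiber (q : Icc (-1 : ℝ) 1) :
    canonicalForm.pullback cotangentDiskModel 𝓘(ℝ, ℝ) (cotangentFiber q) = 0 := by
  rw [canonicalForm_eq_smul_differential, OneForm.pullback_smul, OneForm.pullback_differential
    (contMDiff_baseCoordinate.mdifferentiable (by simp))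
    ((contMDiff_cotangentFiber q).mdifferentiable (by simp))]
  exact (congrArg _ (OneForm.differential_const (q : ℝ))).trans (smul_zero _)

theorem isExactLagrangianEmbedding_cotangentFiber {q : Icc (-1 : ℝ) 1}
    (hq : (q : ℝ) ∈ Ioo (-1 : ℝ) 1) :
    IsExactLagrangianEmbedding cotangentDiskModel 𝓘(ℝ, ℝ) canonicalForm (cotangentFiber q) where
  smooth := contMDiff_cotangentFiber q
  injective := Prod.mk_right_injective q
  injective_mfderiv p := by
    change Function.Injective (mfderiv 𝓘(ℝ, ℝ) ((𝓡∂ 1).prod 𝓘(ℝ, ℝ)) (fun p => (q, p)) p)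
    rw [mfderiv_prod_right]
    exact Prod.mk_right_injective 0
  proper := IsClosedEmbedding.isProperMap ⟨isEmbedding_prodMkRight q, by
    rw [range_cotangentFiber]
    exact isClosed_eq continuous_fst continuous_const⟩
  interior p := by
    rw [ModelWithCorners.interior_prod, ModelWithCorners.interior_eq_univ (I := 𝓘(ℝ, ℝ))]
    exact ⟨Icc_isInteriorPoint_interior hq, trivial⟩
  half_dim := by simp
  isotropic p u v := by
    have eq_smul (D : ℝ →L[ℝ] EuclideanSpace ℝ (Fin 1) × ℝ) (w : ℝ) : D w = w • D 1 := by
      rw [← map_smul, smul_eq_mul, mul_one]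
    refine (congrArg₂ (canonicalForm.d cotangentDiskModel (cotangentFiber q p))
      (eq_smul _ u) (eq_smul _ v)).trans ?_
    exact OneForm.d_smul_smul _ _ _ _ _
  exact := ⟨fun _ => 0, contMDiff_const, fun p u => by
    rw [pullback_canonicalForm_cotangentFiber, mfderiv_const]
    rfl⟩

theorem isExactLagrangianIsotopy_cotangentFiber {c : ℝ → Icc (-1 : ℝ) 1}
    (c_smooth : ContMDiffOn 𝓘(ℝ, ℝ) (𝓡∂ 1) ∞ c (Icc 0 1))
    (c_interior : ∀ t ∈ Icc (0 : ℝ) 1, (c t : ℝ) ∈ Ioo (-1 : ℝ) 1) :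
    IsExactLagrangianIsotopy cotangentDiskModel 𝓘(ℝ, ℝ) canonicalForm
      fun t => cotangentFiber (c t) where
  smooth := (c_smooth.comp contMDiff_fst.contMDiffOn fun _ hp => hp.1).prodMk
    contMDiff_snd.contMDiffOn
  proper := c_smooth.continuousOn.domRestrict.isProperMap.prodMap isProperMap_id
  embedding t ht := isExactLagrangianEmbedding_cotangentFiber (c_interior t ht)

theorem exists_contMDiffOn_Icc_eq_zero_iff_endpoint :
    ∃ c : ℝ → Icc (-1 : ℝ) 1, ContMDiffOn 𝓘(ℝ, ℝ) (𝓡∂ 1) ∞ c (Icc 0 1) ∧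
      (∀ t ∈ Icc (0 : ℝ) 1, (c t : ℝ) ∈ Ioo (-1 : ℝ) 1) ∧
      ∀ t ∈ Icc (0 : ℝ) 1, (c t : ℝ) = 0 ↔ t = 0 ∨ t = 1 := by
  have mem_Ioo : ∀ t ∈ Icc (0 : ℝ) 1, t * (1 - t) ∈ Ioo (-1 : ℝ) 1 := fun t ht =>
    ⟨by nlinarith [ht.1, ht.2], by nlinarith [ht.1, ht.2]⟩
  have proj_eq : ∀ t ∈ Icc (0 : ℝ) 1,
      (projIcc (-1) 1 (by norm_num) (t * (1 - t)) : ℝ) = t * (1 - t) := fun t ht =>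
    congrArg Subtype.val (projIcc_of_mem (by norm_num) (Ioo_subset_Icc_self (mem_Ioo t ht)))
  refine ⟨fun t => projIcc (-1) 1 (by norm_num) (t * (1 - t)), ?_, fun t ht => ?_, fun t ht => ?_⟩
  · exact contMDiffOn_projIcc.comp (ContDiff.contMDiff (by fun_prop)).contMDiffOn
      fun t ht => Ioo_subset_Icc_self (mem_Ioo t ht)
  · rw [proj_eq t ht]
    exact mem_Ioo t ht
  · rw [proj_eq t ht, mul_eq_zero, sub_eq_zero, eq_comm (a := 1)]

end CotangentFibers

section Stabilization

variable {E : Type*} [NormedAddCommGroup E] [NormedSpace ℝ E]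
  {H : Type*} [TopologicalSpace H] {I : ModelWithCorners ℝ E H}
  {X : Type*} [TopologicalSpace X] [ChartedSpace H X]
  {F : Type*} [NormedAddCommGroup F] [NormedSpace ℝ F]
  {G : Type*} [TopologicalSpace G] {J : ModelWithCorners ℝ F G}
  {M : Type*} [TopologicalSpace M] [ChartedSpace G M]

theorem pullback_stabilize_prodMap_cotangentFiber {μ : OneForm I X} {f : M → X}
    (hf : MDifferentiable J I f) (hμ : μ.pullback I J f = 0) (q : Icc (-1 : ℝ) 1) :
    (μ.stabilize I).pullback (I.prod cotangentDiskModel) (J.prod 𝓘(ℝ, ℝ))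
      (Prod.map f (cotangentFiber q)) = 0 := by
  rw [μ.stabilize_eq_prod, OneForm.pullback_prod_prodMap μ canonicalForm hf
    ((contMDiff_cotangentFiber q).mdifferentiable (by simp)), hμ,
    pullback_canonicalForm_cotangentFiber, OneForm.prod_zero_zero]

theorem IsExactLagrangianIsotopy.stabilize [FiniteDimensional ℝ E] [FiniteDimensional ℝ F]
    [IsManifold I ∞ X] {θ : OneForm I X} (hθ : θ.IsSmooth I) {φ : ℝ → M → X}
    (hφ : IsExactLagrangianIsotopy I J θ φ) {c : ℝ → Icc (-1 : ℝ) 1}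
    (c_smooth : ContMDiffOn 𝓘(ℝ, ℝ) (𝓡∂ 1) ∞ c (Icc 0 1))
    (c_interior : ∀ t ∈ Icc (0 : ℝ) 1, (c t : ℝ) ∈ Ioo (-1 : ℝ) 1) :
    IsExactLagrangianIsotopy (I.prod cotangentDiskModel) (J.prod 𝓘(ℝ, ℝ)) (θ.stabilize I)
      fun t => Prod.map (φ t) (cotangentFiber (c t)) := by
  rw [θ.stabilize_eq_prod]
  exact hφ.prodMap hθ isSmooth_canonicalForm
    (isExactLagrangianIsotopy_cotangentFiber c_smooth c_interior)

end Stabilization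

theorem mainTheorem9_general
    {E : Type*} [NormedAddCommGroup E] [NormedSpace ℝ E] [FiniteDimensional ℝ E]
    {H : Type*} [TopologicalSpace H] {I : ModelWithCorners ℝ E H}
    {X : Type*} [TopologicalSpace X] [ChartedSpace H X] [IsManifold I ∞ X]
    {θ : OneForm I X} (hθ : θ.IsSmooth I)
    {F : Type*} [NormedAddCommGroup F] [NormedSpace ℝ F] [FiniteDimensional ℝ F]
    {G : Type*} [TopologicalSpace G] {J : ModelWithCorners ℝ F G}
    {M : Type*} [TopologicalSpace M] [ChartedSpace G M]
    {N : Type*} [TopologicalSpace N] [ChartedSpace G N]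
    {φ : ℝ → M → X} (hφ : IsExactLagrangianIsotopy I J θ φ)
    {ψ : ℝ → N → X} (hψ : IsExactLagrangianIsotopy I J θ ψ)
    (disjoint_zero : Disjoint (range (φ 0)) (range (ψ 0)))
    (disjoint_one : Disjoint (range (φ 1)) (range (ψ 1))) :
    ∃ (Φ : ℝ → M × ℝ → X × CotangentDisk) (Ψ : ℝ → N × ℝ → X × CotangentDisk),
      IsExactLagrangianLinkIsotopy (I.prod cotangentDiskModel) (J.prod 𝓘(ℝ, ℝ))
        (θ.stabilize I) Φ Ψ ∧
      range (Φ 0) = range (φ 0) ×ˢ zeroFiber ∧ range (Φ 1) = range (φ 1) ×ˢ zeroFiber ∧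
      range (Ψ 0) = range (ψ 0) ×ˢ zeroFiber ∧ range (Ψ 1) = range (ψ 1) ×ˢ zeroFiber ∧
      (∀ (μ : OneForm I X), ∀ t ∈ Icc (0 : ℝ) 1,
        ((∀ m, μ.pullback I J (φ t) m = 0) →
          ∀ z, (μ.stabilize I).pullback (I.prod cotangentDiskModel) (J.prod 𝓘(ℝ, ℝ))
            (Φ t) z = 0) ∧
        ((∀ m, μ.pullback I J (ψ t) m = 0) →
          ∀ z, (μ.stabilize I).pullback (I.prod cotangentDiskModel) (J.prod 𝓘(ℝ, ℝ))
            (Ψ t) z = 0)) := by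
  obtain ⟨c, c_smooth, c_interior, c_eq_zero⟩ := exists_contMDiffOn_Icc_eq_zero_iff_endpoint
  let o : Icc (-1 : ℝ) 1 := ⟨0, by norm_num⟩
  refine ⟨fun t => Prod.map (φ t) (cotangentFiber (c t)),
    fun t => Prod.map (ψ t) (cotangentFiber o),
    ⟨hφ.stabilize hθ c_smooth c_interior, hψ.stabilize hθ contMDiffOn_const fun _ _ => by simp [o],
      fun t ht => ?_⟩,
    range_prodMap_cotangentFiber _ ((c_eq_zero 0 (by simp)).2 (.inl rfl)),
    range_prodMap_cotangentFiber _ ((c_eq_zero 1 (by simp)).2 (.inr rfl)),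
    range_prodMap_cotangentFiber _ rfl, range_prodMap_cotangentFiber _ rfl,
    fun μ t ht => ⟨fun hμ => ?_, fun hμ => ?_⟩⟩
  · rw [range_prodMap, range_prodMap, disjoint_prod]
    by_cases fiber_eq : c t = o
    · rcases (c_eq_zero t ht).1 (congrArg Subtype.val fiber_eq) with rfl | rfl
      exacts [.inl disjoint_zero, .inl disjoint_one]
    · exact .inr (disjoint_range_cotangentFiber fiber_eq)
  · exact congrFun (pullback_stabilize_prodMap_cotangentFiber
      ((hφ.embedding t ht).smooth.mdifferentiable (by simp)) (funext hμ) _)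
  · exact congrFun (pullback_stabilize_prodMap_cotangentFiber
      ((hψ.embedding t ht).smooth.mdifferentiable (by simp)) (funext hμ) _)

theorem mainTheorem9 {n : ℕ}
    {E : Type*} [NormedAddCommGroup E] [NormedSpace ℝ E] [FiniteDimensional ℝ E]
    (hE : Module.finrank ℝ E = 2 * n)
    {H : Type*} [TopologicalSpace H] (I : ModelWithCorners ℝ E H)
    {X : Type*} [TopologicalSpace X] [ChartedSpace H X] [IsManifold I ∞ X]
    (θ : OneForm I X) (hθ : IsExactSymplectic I θ)
    {M : Type*} [TopologicalSpace M] [ChartedSpace (EuclideanSpace ℝ (Fin n)) M]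
    [IsManifold (𝓡 n) ∞ M]
    {N : Type*} [TopologicalSpace N] [ChartedSpace (EuclideanSpace ℝ (Fin n)) N]
    [IsManifold (𝓡 n) ∞ N]
    (L L' K K' : Set X) (hLK : Disjoint L K) (hLK' : Disjoint L' K')
    (φ : ℝ → M → X) (hφ : IsExactLagrangianIsotopy I (𝓡 n) θ φ)
    (hφ₀ : range (φ 0) = L) (hφ₁ : range (φ 1) = L')
    (ψ : ℝ → N → X) (hψ : IsExactLagrangianIsotopy I (𝓡 n) θ ψ)
    (hψ₀ : range (ψ 0) = K) (hψ₁ : range (ψ 1) = K') :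
    ∃ (Φ : ℝ → M × ℝ → X × CotangentDisk) (Ψ : ℝ → N × ℝ → X × CotangentDisk),
      IsExactLagrangianLinkIsotopy (I.prod cotangentDiskModel) ((𝓡 n).prod 𝓘(ℝ, ℝ))
        (θ.stabilize I) Φ Ψ ∧
      range (Φ 0) = L ×ˢ zeroFiber ∧ range (Φ 1) = L' ×ˢ zeroFiber ∧
      range (Ψ 0) = K ×ˢ zeroFiber ∧ range (Ψ 1) = K' ×ˢ zeroFiber ∧
      -- components on which a one-form `μ` vanishes move through components on which
      -- the product one-form `μ + p dq` vanishes
      (∀ (μ : OneForm I X), ∀ t ∈ Icc (0 : ℝ) 1,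
        ((∀ m, μ.pullback I (𝓡 n) (φ t) m = 0) →
          ∀ z, (μ.stabilize I).pullback (I.prod cotangentDiskModel)
            ((𝓡 n).prod 𝓘(ℝ, ℝ)) (Φ t) z = 0) ∧
        ((∀ m, μ.pullback I (𝓡 n) (ψ t) m = 0) →
          ∀ z, (μ.stabilize I).pullback (I.prod cotangentDiskModel)
            ((𝓡 n).prod 𝓘(ℝ, ℝ)) (Ψ t) z = 0)) := by
  subst hφ₀ hφ₁ hψ₀ hψ₁
  exact mainTheorem9_general hθ.smooth hφ hψ hLK hLK'
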